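/- Let $n\ge 2$, let $H_0\in\mathbb C^{n\times n}$ be Hermitian, let $V_1,\dots,V_r\in\mathbb C^{n\times n}$ be arbitrary, and let $-L$ be the Kossakowski--Lindblad generator given by $$L(\rho)=\mathrm i[H_0,\rho]+\sum_{k=1}^r\Big(\tfrac12\big(V_k^*V_k\rho+\rho V_k^*V_k\big)-V_k\rho V_k^*\Big).$$ Assume that $-L$ is unital, i.e. $L(\mathbb 1)=0$. For $U\in\mathrm{SU}(n)$ and $\lambda\in\mathbb R^n$ let $-L_U\lambda\in\mathbb R^n$ be the vector of diagonal entries of $-U^*L(U\,\mathrm{diag}(\lambda)\,U^*)U$, and for $\lambda$ in the standard simplex $\Delta^{n-1}$ put $\mathsf{derv}(\lambda)=\{-L_U\lambda:U\in\mathrm{SU}(n)\}$. The point $\lambda\in\Delta^{n-1}$ is called stabilizable if $0\in\operatorname{conv}(\mathsf{derv}(\lambda))$, and strongly stabilizable if $0\in\mathsf{derv}(\lambda)$. A unital subalgebra $\mathcal A\subseteq\mathbb C^{n\times n}$ is said to be of type $\tau$ if there are a unitary $U$ and positive integers $q_1,\dots,q_m,k_1,\dots,k_m$ such that $U\mathcal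 AU^*=\bigoplus_{i=1}^m\mathbb C^{q_i\times q_i}\otimes\mathbb 1_{k_i}$ and $\tau$ is the multiset in which each $i$ contributes $k_i$ copies of $q_i$. A vector $v\in\mathbb N^k$ of positive integers is a refinement of a vector $w\in\mathbb N^l$ of positive integers if $Av=w$ for some $A\in\{0,1\}^{l\times k}$ each of whose columns sums to $1$; vectors differing by a permutation are identified, so that refinement is a relation between multisets. Let $\mathcal V$ be the relaxation algebra of $-L$, i.e. the algebra generated by $\mathbb 1,V_1,\dots,V_r$. Then: (a) $\mathcal V$ has a type, and this type is unique; it is called the type of $-L$. (b) A point $\lambda\in\Delta^{n-1}$ is stabilizable if and only if the type of $-L$ is a refinement of the vector of multiplicities of $\lambda$, that is, of the vector of the multiplicities of the distinct values among $\lambda_1,\dots,\lambda_n$ (including the value $0$, if it occurs). (c) The set of stabilizable points equals the set of strongly stabilizable points. -/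

import Mathlib

open scoped Matrix Kronecker

noncomputable section

namespace Lindblad

/-- The operator `L = i ad_H + ∑ₖ Γ_{Vₖ}` on complex `n × n` matrices, where `ad_H ρ = Hρ - ρH` and
`Γ_V ρ = (V*Vρ + ρV*V) / 2 - VρV*`. For Hermitian `H`, the operator `-L` is the
Kossakowski-Lindblad generator with Hamiltonian `H` and Lindblad terms `V₁, …, V_r`. -/
def lindbladOperator {n r : ℕ} (H : Matrix (Fin n) (Fin n) ℂ)
    (V : Fin r → Matrix (Fin n) (Fin n) ℂ) :
    Matrix (Fin n) (Fin n) ℂ →ₗ[ℂ] Matrix (Fin n) (Fin n) ℂ where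
  toFun ρ := Complex.I • (H * ρ - ρ * H) +
    ∑ k, ((1 / 2 : ℂ) • ((V k)ᴴ * V k * ρ + ρ * ((V k)ᴴ * V k)) - V k * ρ * (V k)ᴴ)
  map_add' ρ σ := by
    simp only [mul_add, add_mul, smul_add, smul_sub, Finset.sum_sub_distrib, Finset.sum_add_distrib]
    abel
  map_smul' c ρ := by
    simp only [Matrix.mul_smul, Matrix.smul_mul, RingHom.id_apply, smul_add, smul_sub,
      Finset.smul_sum, smul_comm c]

/-- The system with generator `-L` is unital if `L 1 = 0`. -/
def IsUnital {n : ℕ} (L : Matrix (Fin n) (Fin n) ℂ →ₗ[ℂ] Matrix (Fin n) (Fin n) ℂ) : Prop :=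
  L 1 = 0

/-- The relaxation algebra: the complex matrix algebra generated by `1` and the Lindblad terms. -/
def relaxationAlgebra {n r : ℕ} (V : Fin r → Matrix (Fin n) (Fin n) ℂ) :
    Subalgebra ℂ (Matrix (Fin n) (Fin n) ℂ) :=
  Algebra.adjoin ℂ (Set.range V)

/-- The induced vector field `-L_U` on `ℝⁿ`: the diagonal of `-U* L(U diag(x) U*) U`.
(This diagonal is real if `L` maps Hermitian matrices to Hermitian matrices, as every
`lindbladOperator` of a Hermitian `H` does, so taking real parts loses nothing.) -/
def inducedField {n : ℕ} (L : Matrix (Fin n) (Fin n) ℂ →ₗ[ℂ] Matrix (Fin n) (Fin n) ℂ)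
    (U : Matrix (Fin n) (Fin n) ℂ) (x : Fin n → ℝ) : Fin n → ℝ :=
  fun i => -((star U * L (U * Matrix.diagonal (fun j => (x j : ℂ)) * star U) * U) i i).re

/-- The set of achievable derivatives `{-L_U x : U ∈ SU(n)}`. -/
def derv {n : ℕ} (L : Matrix (Fin n) (Fin n) ℂ →ₗ[ℂ] Matrix (Fin n) (Fin n) ℂ)
    (x : Fin n → ℝ) : Set (Fin n → ℝ) :=
  {y | ∃ U ∈ Matrix.specialUnitaryGroup (Fin n) ℂ, y = inducedField L U x}

/-- The stabilizable points of the reduced control system on the simplex. -/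
def stab {n : ℕ} (L : Matrix (Fin n) (Fin n) ℂ →ₗ[ℂ] Matrix (Fin n) (Fin n) ℂ) :
    Set (Fin n → ℝ) :=
  {x | x ∈ stdSimplex ℝ (Fin n) ∧ (0 : Fin n → ℝ) ∈ convexHull ℝ (derv L x)}

/-- The strongly stabilizable points of the reduced control system on the simplex. -/
def strongStab {n : ℕ} (L : Matrix (Fin n) (Fin n) ℂ →ₗ[ℂ] Matrix (Fin n) (Fin n) ℂ) :
    Set (Fin n → ℝ) :=
  {x | x ∈ stdSimplex ℝ (Fin n) ∧ (0 : Fin n → ℝ) ∈ derv L x}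

/-- `𝒜` is of type `τ`: for some unitary `U` (and some identification `e` of the index sets),
`U 𝒜 U* = ⨁ᵢ ℂ^{qᵢ × qᵢ} ⊗ 1_{kᵢ}` with positive `qᵢ`, `kᵢ`, and `τ` is the multiset of block sizes,
in which each `i` contributes `kᵢ` copies of `qᵢ`. -/
def IsOfType {n : ℕ} (𝒜 : Subalgebra ℂ (Matrix (Fin n) (Fin n) ℂ)) (τ : Multiset ℕ) : Prop :=
  ∃ (m : ℕ) (q k : Fin m → ℕ), (∀ i, 0 < q i) ∧ (∀ i, 0 < k i) ∧
    τ = ∑ i, Multiset.replicate (k i) (q i) ∧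
    ∃ U ∈ Matrix.unitaryGroup (Fin n) ℂ, ∃ e : Fin n ≃ (Σ i, Fin (q i) × Fin (k i)),
      (fun M => U * M * star U) '' (𝒜 : Set (Matrix (Fin n) (Fin n) ℂ)) =
        Set.range (fun B : (∀ i, Matrix (Fin (q i)) (Fin (q i)) ℂ) =>
          (Matrix.blockDiagonal' (fun i =>
            B i ⊗ₖ (1 : Matrix (Fin (k i)) (Fin (k i)) ℂ))).submatrix e e)

/-- `v` is a refinement of `w`: `A v = w` for a matrix `A` with entries in `{0, 1}` all of whose
columns sum to `1`. -/
def IsRefinement {k l : ℕ} (v : Fin k → ℕ) (w : Fin l → ℕ) : Prop :=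
  ∃ A : Matrix (Fin l) (Fin k) ℕ,
    (∀ i j, A i j = 0 ∨ A i j = 1) ∧ (∀ j, ∑ i, A i j = 1) ∧ A *ᵥ v = w

/-- Refinement for vectors up to permutation, i.e. for finite multisets. -/
def Refines (s t : Multiset ℕ) : Prop :=
  ∃ (k l : ℕ) (v : Fin k → ℕ) (w : Fin l → ℕ),
    s = Finset.univ.val.map v ∧ t = Finset.univ.val.map w ∧ IsRefinement v w

/-- The multiplicities of the distinct values (including `0`, if it occurs) among the entries
of `x`. -/
def multiplicities {n : ℕ} (x : Fin n → ℝ) : Multiset ℕ :=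
  (Finset.univ.image x).val.map (fun a => (Finset.univ.filter (fun i => x i = a)).card)

end Lindblad

end

/-! Unitality says `∑ Vₖ* Vₖ = ∑ Vₖ Vₖ*`, and hence `2 tr(ρ L ρ) = ∑ ‖[Vₖ, ρ]‖²` for Hermitian `ρ`.
With `ρ = U diag(λ) U*`, the pairing of `λ` with `-L_U λ` is `-tr(ρ L ρ) ≤ 0`. If `0` lies in the
convex hull of these derivatives, the pairing must vanish for some `U`, and then `ρ` commutes with
every `Vₖ`. Conversely, if such a `ρ` commutes with every `Vₖ`, it also commutes with every `Vₖ*`.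
The dissipative part of `L ρ` is then zero by unitality, and `[H, ρ]` has zero diagonal in an
eigenbasis of `ρ`, so `-L_U λ = 0`. Stabilizable and strongly stabilizable points are therefore both
the points of the simplex that occur as a spectrum in the commutant of the relaxation algebra.

Existence of the type uses the same vanishing of sums of squares: the commutant is closed under
adjoints and invariant subspaces are reducing. The action on `ℂⁿ` is thus semisimple, the double
commutant property makes the algebra closed under adjoints, and Schur's lemma yields the block form
in an orthonormal basis (`exists_adapted_orthonormalBasis`).

The commutant of `⨁ ℂ^{qᵢ × qᵢ} ⊗ 1` is `⨁ 1 ⊗ ℂ^{kᵢ × kᵢ}`, so its Hermitian spectra consist of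
`kᵢ` real numbers for each `i`, each repeated `qᵢ` times. This is refinement
(`exists_commute_conj_diagonal_iff`). It also gives uniqueness: two types of one algebra refine each
other, and refinement is antisymmetric. -/

noncomputable section

namespace Lindblad

/-! ### Orthonormal block decomposition for semisimple actions closed under adjoints. -/

section StarAlgebra

open Module (End)
open scoped InnerProductSpace

variable {E : Type*} [NormedAddCommGroup E] [InnerProductSpace ℂ E] [FiniteDimensional ℂ E]
  {A : Type*} [Ring A] [Algebra ℂ A] [Module A E] [IsScalarTower ℂ A E]

/-- The composition `T* T'` of two homomorphisms from submodules into the ambient space is a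
homomorphism if the algebra is closed under adjoints. -/
theorem exists_adjoint_comp (hstar : ∀ a : A, ∃ b : A, ∀ x y : E, ⟪a • x, y⟫_ℂ = ⟪x, b • y⟫_ℂ)
    {S S' : Submodule A E} (T : S →ₗ[A] E) (T' : S' →ₗ[A] E) :
    ∃ R : S' →ₗ[A] S, ∀ (s : S) (s' : S'), ⟪(s : E), (R s' : E)⟫_ℂ = ⟪T s, T' s'⟫_ℂ := by
  let T₀ : (S.restrictScalars ℂ) →ₗ[ℂ] E := T.restrictScalars ℂ
  let Ts : E → S := LinearMap.adjoint T₀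
  have key : ∀ (s : S) (e : E), ⟪(s : E), (Ts e : E)⟫_ℂ = ⟪T s, e⟫_ℂ :=
    fun s e => LinearMap.adjoint_inner_right T₀ s e
  have ext' : ∀ x y : S, (∀ s : S, ⟪(s : E), (x : E)⟫_ℂ = ⟪(s : E), (y : E)⟫_ℂ) → x = y :=
    fun x y h => ext_inner_left (E := S.restrictScalars ℂ) ℂ h
  have hadd : ∀ x y, Ts (x + y) = Ts x + Ts y := fun x y => map_add (LinearMap.adjoint T₀) x y
  have hlin : ∀ (a : A) (e : E), Ts (a • e) = a • Ts e := by
    intro a e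
    refine ext' _ _ fun s => ?_
    obtain ⟨b, hb⟩ := hstar a
    have hb' : ∀ x y : E, ⟪x, a • y⟫_ℂ = ⟪b • x, y⟫_ℂ := fun x y => by
      rw [← inner_conj_symm, hb, inner_conj_symm]
    rw [key, hb', ← map_smul, ← key, Submodule.coe_smul, Submodule.coe_smul, hb']
  exact ⟨{ toFun := fun s' => Ts (T' s')
           map_add' := fun x y => by rw [map_add, hadd]
           map_smul' := fun a x => by rw [map_smul, hlin]; rfl }, fun s s' => key s (T' s')⟩

/-- Schur's lemma over `ℂ`: `T* T'` is an endomorphism of a simple module, hence a scalar. -/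
theorem exists_inner_eq_mul_inner
    (hstar : ∀ a : A, ∃ b : A, ∀ x y : E, ⟪a • x, y⟫_ℂ = ⟪x, b • y⟫_ℂ)
    {S : Submodule A E} [IsSimpleModule A S] (T T' : S →ₗ[A] E) :
    ∃ c : ℂ, ∀ s s' : S, ⟪T s, T' s'⟫_ℂ = c * ⟪(s : E), (s' : E)⟫_ℂ := by
  obtain ⟨R, hR⟩ := exists_adjoint_comp hstar T T'
  have : FiniteDimensional ℂ S :=
    inferInstanceAs (FiniteDimensional ℂ (S.restrictScalars ℂ))
  obtain ⟨c, hc⟩ := (IsSimpleModule.algebraMap_end_bijective_of_isAlgClosed (A := A) (V := S) ℂ).2 R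
  refine ⟨c, fun s s' => ?_⟩
  rw [← hR, ← hc]
  change ⟪(s : E), c • (s' : E)⟫_ℂ = _
  rw [inner_smul_right]

/-- Schur's lemma again: `T* T'` maps between non-isomorphic simple modules, hence vanishes. -/
theorem inner_eq_zero_of_not_equiv
    (hstar : ∀ a : A, ∃ b : A, ∀ x y : E, ⟪a • x, y⟫_ℂ = ⟪x, b • y⟫_ℂ)
    {S S' : Submodule A E} [IsSimpleModule A S] [IsSimpleModule A S']
    (h : IsEmpty (S' ≃ₗ[A] S)) (T : S →ₗ[A] E) (T' : S' →ₗ[A] E) (s : S) (s' : S') :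
    ⟪T s, T' s'⟫_ℂ = 0 := by
  obtain ⟨R, hR⟩ := exists_adjoint_comp hstar T T'
  rcases LinearMap.bijective_or_eq_zero R with hb | h0
  · exact (h.false (LinearEquiv.ofBijective R hb)).elim
  · rw [← hR, h0]; simp

/-- Double commutant property: Jacobson density on a finite spanning set determines the operator
everywhere. -/
theorem exists_smul_eq_of_forall_commute [IsSemisimpleModule A E] (M : End ℂ E)
    (hM : ∀ C : End A E, ∀ e, M (C e) = C (M e)) : ∃ a : A, ∀ e, M e = a • e := by
  let f : End (End A E) E :=
    { toFun := M, map_add' := map_add M, map_smul' := fun C e => hM C e }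
  obtain ⟨s, hs⟩ := Module.Finite.fg_top (R := ℂ) (M := E)
  obtain ⟨r, hr⟩ := jacobson_density (R := A) f s
  have : M = Algebra.lsmul ℂ ℂ E r := LinearMap.ext_on hs fun m hm => hr m hm
  exact ⟨r, fun e => by rw [this]; rfl⟩

variable (A E) in
/-- Representatives of the isomorphism classes of simple submodules. -/
theorem exists_simple_representatives [IsSemisimpleModule A E] :
    ∃ (m : ℕ) (S : Fin m → Submodule A E), (∀ i, IsSimpleModule A (S i)) ∧
      (∀ i j, i ≠ j → IsEmpty (S i ≃ₗ[A] S j)) ∧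
      ∀ N : Submodule A E, IsSimpleModule A N → ∃ i, Nonempty (S i ≃ₗ[A] N) := by
  have : Module.Finite A E := Module.Finite.of_restrictScalars_finite ℂ A E
  have e := Finite.equivFin (isotypicComponents A E)
  choose S hS hc using fun c : isotypicComponents A E => c.2
  refine ⟨_, fun i => S (e.symm i), fun i => hS _, fun i j hij => ⟨fun g => hij ?_⟩, fun N hN => ?_⟩
  · refine e.symm.injective (Subtype.ext ?_)
    rw [hc, hc (e.symm j)]
    exact g.isotypicComponent_eq
  · let c : isotypicComponents A E := ⟨_, N, hN, rfl⟩
    have hle : S c ≤ isotypicComponent A E N :=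
      (Submodule.le_isotypicComponent (S c)).trans (hc c).ge
    have := hS c
    obtain ⟨g⟩ := isIsotypicOfType_submodule_iff.mp (.isotypicComponent A E N) _ hle
    exact ⟨e c, ⟨(LinearEquiv.ofEq _ _ (congrArg S (e.symm_apply_apply c))).trans g⟩⟩

/-- An orthonormal frame of the space of homomorphisms from a simple submodule. -/
theorem exists_orthonormal_homs
    (hstar : ∀ a : A, ∃ b : A, ∀ x y : E, ⟪a • x, y⟫_ℂ = ⟪x, b • y⟫_ℂ)
    (S : Submodule A E) [IsSimpleModule A S] :
    ∃ (k : ℕ) (T : Fin k → S →ₗ[A] E), 0 < k ∧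
      (∀ j j' (s s' : S), ⟪T j s, T j' s'⟫_ℂ = if j = j' then ⟪(s : E), (s' : E)⟫_ℂ else 0) ∧
      ∀ R : S →ₗ[A] E, ∃ c : Fin k → ℂ, ∀ s, R s = ∑ j, c j • T j s := by
  have hnt := IsSimpleModule.nontrivial A S
  have : Nontrivial (S.restrictScalars ℂ) := hnt
  obtain ⟨s₀, hs₀⟩ : ∃ s₀ : S, ‖(s₀ : E)‖ = 1 := exists_norm_eq (S.restrictScalars ℂ) zero_le_one
  have hn : ⟪(s₀ : E), (s₀ : E)⟫_ℂ = 1 := by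
    rw [inner_self_eq_norm_sq_to_K, hs₀]; simp
  have hne : s₀ ≠ 0 := fun h => by simp [h] at hs₀
  have hinj : ∀ R : S →ₗ[A] E, R s₀ = 0 → R = 0 := fun R hR => by
    by_contra h
    exact hne ((LinearMap.injective_of_ne_zero h) (by rw [hR, map_zero]))
  -- Evaluation at the unit vector `s₀` embeds the homomorphisms into `E`. An orthonormal basis of
  -- its range lifts to the frame, since by Schur all inner products are fixed by their values at
  -- `s₀`.
  let ev : (S →ₗ[A] E) →ₗ[ℂ] E :=
    { toFun := fun R => R s₀, map_add' := fun _ _ => rfl, map_smul' := fun _ _ => rfl }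
  let F := LinearMap.range ev
  let f := stdOrthonormalBasis ℂ F
  choose T hT using fun j => (f j).2
  have hTf : ∀ j, T j s₀ = f j := hT
  have hsum : ∀ R : S →ₗ[A] E, ∃ c : _ → ℂ, ∀ s, R s = ∑ j, c j • T j s := by
    intro R
    let w : F := ⟨ev R, R, rfl⟩
    refine ⟨fun j => f.repr w j, fun s => ?_⟩
    have h := hinj (R - ∑ j, f.repr w j • T j) (by
      have := congrArg (Subtype.val) (f.sum_repr w)
      simp only [AddSubmonoidClass.coe_finsetSum, Submodule.coe_smul] at this
      simp only [LinearMap.sub_apply, LinearMap.sum_apply, LinearMap.smul_apply, hTf, this]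
      exact sub_self _)
    have := LinearMap.congr_fun (sub_eq_zero.mp h) s
    simpa [LinearMap.sum_apply] using this
  refine ⟨_, T, ?_, fun j j' s s' => ?_, hsum⟩
  -- An empty frame would force the inclusion of `S` to vanish.
  · by_contra h0
    obtain ⟨c, hc⟩ := hsum S.subtype
    have : IsEmpty (Fin (Module.finrank ℂ F)) := ⟨fun j => h0 (j.pos)⟩
    have := hc s₀
    simp only [Finset.univ_eq_empty, Finset.sum_empty] at this
    exact hne (Subtype.ext this)
  · obtain ⟨c, hc⟩ := exists_inner_eq_mul_inner hstar (T j) (T j')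
    have h1 := hc s₀ s₀
    rw [hn, mul_one, hTf, hTf, ← Submodule.coe_inner, orthonormal_iff_ite.mp f.orthonormal] at h1
    rw [hc, ← h1]
    simp

theorem exists_orthonormal_frame (S : Submodule A E) [Nontrivial S] :
    ∃ (q : ℕ) (s : Fin q → S), 0 < q ∧
      (∀ l l', ⟪(s l : E), (s l' : E)⟫_ℂ = if l = l' then 1 else 0) ∧
      ∀ x : S, ∃ c : Fin q → ℂ, x = ∑ l, c l • s l := by
  have : Nontrivial (S.restrictScalars ℂ) := ‹Nontrivial S›
  let s := stdOrthonormalBasis ℂ (S.restrictScalars ℂ)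
  exact ⟨_, s, Module.finrank_pos, orthonormal_iff_ite.mp s.orthonormal,
    fun x => ⟨s.repr x, (s.sum_repr x).symm⟩⟩

/-- Structure theorem: a semisimple action of an algebra closed under adjoints is, in a suitable
orthonormal basis, the action of a direct sum of full matrix algebras with multiplicities. -/
theorem exists_adapted_orthonormalBasis [IsSemisimpleModule A E]
    (hstar : ∀ a : A, ∃ b : A, ∀ x y : E, ⟪a • x, y⟫_ℂ = ⟪x, b • y⟫_ℂ) :
    ∃ (m : ℕ) (q k : Fin m → ℕ), (∀ i, 0 < q i) ∧ (∀ i, 0 < k i) ∧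
      ∃ b : OrthonormalBasis (Σ i, Fin (q i) × Fin (k i)) ℂ E, ∀ M : End ℂ E,
        (∃ a : A, ∀ e, M e = a • e) ↔ ∃ B : ∀ i, Matrix (Fin (q i)) (Fin (q i)) ℂ,
          ∀ i l j, M (b ⟨i, l, j⟩) = ∑ l', B i l' l • b ⟨i, l', j⟩ := by
  obtain ⟨m, S, hS, hne, hrep⟩ := exists_simple_representatives (A := A) (E := E)
  have hnt := fun i => IsSimpleModule.nontrivial A (S i)
  choose k T hk hT hsp using fun i => exists_orthonormal_homs hstar (S i)
  choose q s hq hs hspan using fun i => exists_orthonormal_frame (S i)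
  have hC : ∀ {i} (R : S i →ₗ[A] E) (c : Fin (q i) → ℂ),
      R (∑ l, c l • s i l) = ∑ l, c l • R (s i l) := fun R c =>
    (map_sum (R.restrictScalars ℂ) _ _).trans
      (Finset.sum_congr rfl fun l _ => map_smul (R.restrictScalars ℂ) _ _)
  let b₀ : (Σ i, Fin (q i) × Fin (k i)) → E := fun p => T p.1 p.2.2 (s p.1 p.2.1)
  have hon : Orthonormal ℂ b₀ := by
    rw [orthonormal_iff_ite]
    rintro ⟨i, l, j⟩ ⟨i', l', j'⟩
    by_cases hi : i = i'
    · subst hi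
      change ⟪T i j (s i l), T i j' (s i l')⟫_ℂ = _
      rw [hT, hs]
      by_cases hj : j = j' <;> by_cases hl : l = l' <;> simp [hj, hl]
    · rw [if_neg (fun h => hi (congrArg Sigma.fst h))]
      exact inner_eq_zero_of_not_equiv hstar (hne _ _ (Ne.symm hi)) _ _ _ _
  have htop : ⊤ ≤ Submodule.span ℂ (Set.range b₀) := by
    intro e _
    have he : e ∈ sSup {N : Submodule A E | IsSimpleModule A N} :=
      (IsSemisimpleModule.sSup_simples_eq_top A E).ge trivial
    rw [sSup_eq_iSup'] at he
    refine Submodule.iSup_induction _ (motive := fun e => e ∈ Submodule.span ℂ (Set.range b₀)) he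
      ?_ (Submodule.zero_mem _) fun _ _ => Submodule.add_mem _
    rintro ⟨N, hN⟩ x hx
    obtain ⟨i, ⟨g⟩⟩ := hrep N hN
    obtain ⟨c, hc⟩ := hsp i (N.subtype ∘ₗ g.toLinearMap)
    obtain ⟨d, hd⟩ := hspan i (g.symm ⟨x, hx⟩)
    have hx' : x = ∑ j, c j • ∑ l, d l • b₀ ⟨i, l, j⟩ := by
      have := hc (g.symm ⟨x, hx⟩)
      simp only [LinearMap.comp_apply, LinearEquiv.coe_coe, LinearEquiv.apply_symm_apply,
        Submodule.subtype_apply] at this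
      rw [this]
      refine Finset.sum_congr rfl fun j _ => ?_
      rw [hd, hC]
    rw [hx']
    exact Submodule.sum_mem _ fun j _ => Submodule.smul_mem _ _ <|
      Submodule.sum_mem _ fun l _ => Submodule.smul_mem _ _ (Submodule.subset_span ⟨_, rfl⟩)
  let b := OrthonormalBasis.mk hon htop
  have hb : ∀ i l j, b ⟨i, l, j⟩ = T i j (s i l) :=
    fun i l j => congrFun (OrthonormalBasis.coe_mk hon htop) _
  refine ⟨m, q, k, hq, hk, b, fun M => ⟨?_, ?_⟩⟩
  · rintro ⟨a, ha⟩
    choose B hB using fun i l => hspan i (a • s i l)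
    refine ⟨fun i l' l => B i l l', fun i l j => ?_⟩
    simp only [hb, ha]
    rw [← map_smul, hB, hC]
  · rintro ⟨B, hB⟩
    -- The block formula passes from the frame `T i j` to every homomorphism `R`. Taking `R = C ∘ T
    -- i j` then shows that `M` commutes with each module endomorphism `C`.
    have hM : ∀ i (R : S i →ₗ[A] E) l, M (R (s i l)) = ∑ l', B i l' l • R (s i l') := by
      intro i R l
      obtain ⟨c, hc⟩ := hsp i R
      simp only [hb] at hB
      simp only [hc, map_sum, map_smul, hB, Finset.smul_sum]
      rw [Finset.sum_comm]
      exact Finset.sum_congr rfl fun l' _ => Finset.sum_congr rfl fun j _ => smul_comm _ _ _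
    refine exists_smul_eq_of_forall_commute M fun C e => ?_
    have : M ∘ₗ C.restrictScalars ℂ = C.restrictScalars ℂ ∘ₗ M := by
      refine b.toBasis.ext ?_
      rintro ⟨i, l, j⟩
      have h1 := hM i (C ∘ₗ T i j) l
      simp only [LinearMap.comp_apply] at h1
      simp only [OrthonormalBasis.coe_toBasis, LinearMap.comp_apply, LinearMap.restrictScalars_apply,
        hb, hM, h1]
      exact ((map_sum (C.restrictScalars ℂ) _ _).trans
        (Finset.sum_congr rfl fun l _ => map_smul (C.restrictScalars ℂ) _ _)).symm
    exact LinearMap.congr_fun this e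

end StarAlgebra

/-! ### From adapted orthonormal bases to types of matrix algebras. -/

section MatrixAlgebra

open scoped InnerProductSpace
open Module (End)

/-- Matrices as operators on Euclidean space. -/
def euclideanEnd (n : ℕ) :
    Matrix (Fin n) (Fin n) ℂ ≃⋆ₐ[ℂ] End ℂ (EuclideanSpace ℂ (Fin n)) :=
  (LinearMap.toMatrixOrthonormal (EuclideanSpace.basisFun (Fin n) ℂ)).symm

theorem euclideanEnd_apply {n : ℕ} (M : Matrix (Fin n) (Fin n) ℂ) (x : EuclideanSpace ℂ (Fin n))
    (i : Fin n) : euclideanEnd n M x i = ∑ j, M i j * x j := by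
  have : euclideanEnd n M = Matrix.toEuclideanLin M := rfl
  rw [this]
  rfl

theorem inner_euclideanEnd {n : ℕ} (M : Matrix (Fin n) (Fin n) ℂ)
    (x y : EuclideanSpace ℂ (Fin n)) :
    ⟪euclideanEnd n M x, y⟫_ℂ = ⟪x, euclideanEnd n Mᴴ y⟫_ℂ := by
  have h : euclideanEnd n Mᴴ = LinearMap.adjoint (euclideanEnd n M) :=
    map_star (euclideanEnd n) M
  rw [h, LinearMap.adjoint_inner_right]

theorem blockDiagonal'_kronecker_one_apply {m : ℕ} {q k : Fin m → ℕ}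
    (B : ∀ i, Matrix (Fin (q i)) (Fin (q i)) ℂ) (p : Σ i, Fin (q i) × Fin (k i))
    (i : Fin m) (l : Fin (q i)) (j : Fin (k i)) :
    Matrix.blockDiagonal' (fun i => B i ⊗ₖ (1 : Matrix (Fin (k i)) (Fin (k i)) ℂ)) p ⟨i, l, j⟩ =
      ∑ l', B i l' l * if p = ⟨i, l', j⟩ then 1 else 0 := by
  obtain ⟨i', l'', j'⟩ := p
  by_cases hi : i' = i
  · subst hi
    rw [Matrix.blockDiagonal'_apply_eq, Matrix.kroneckerMap_apply, Matrix.one_apply]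
    by_cases hj : j' = j <;> simp [hj]
  · rw [Matrix.blockDiagonal'_apply_ne _ _ _ hi]
    refine (Finset.sum_eq_zero fun l' _ => ?_).symm
    rw [if_neg (fun h => hi (congrArg Sigma.fst h)), mul_zero]

theorem isOfType_of_adapted_orthonormalBasis {n m : ℕ}
    {𝒱 : Subalgebra ℂ (Matrix (Fin n) (Fin n) ℂ)} {q k : Fin m → ℕ}
    (hq : ∀ i, 0 < q i) (hk : ∀ i, 0 < k i)
    (b : OrthonormalBasis (Σ i, Fin (q i) × Fin (k i)) ℂ (EuclideanSpace ℂ (Fin n)))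
    (hb : ∀ M, M ∈ 𝒱 ↔ ∃ B : ∀ i, Matrix (Fin (q i)) (Fin (q i)) ℂ,
      ∀ i l j, euclideanEnd n M (b ⟨i, l, j⟩) = ∑ l', B i l' l • b ⟨i, l', j⟩) :
    IsOfType 𝒱 (∑ i, Multiset.replicate (k i) (q i)) := by
  have hcard : Fintype.card (Fin n) = Fintype.card (Σ i, Fin (q i) × Fin (k i)) := by
    rw [← Module.finrank_eq_card_basis b.toBasis]; simp
  let e := Fintype.equivOfCardEq hcard
  -- The rows are the conjugated basis vectors, so `U M U*` is the matrix of `M` in the basis `b`.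
  let U : Matrix (Fin n) (Fin n) ℂ := Matrix.of fun x i => star (b (e x) i)
  have hU : U * star U = 1 := by
    ext x y
    have := orthonormal_iff_ite.mp b.orthonormal (e x) (e y)
    rw [PiLp.inner_apply] at this
    simp only [EmbeddingLike.apply_eq_iff_eq, RCLike.inner_apply] at this
    simp only [Matrix.mul_apply, Matrix.one_apply, Matrix.star_apply, U, Matrix.of_apply, star_star]
    rw [← this]
    exact Finset.sum_congr rfl fun i _ => mul_comm _ _
  have hconj : ∀ M x y, (U * M * star U) x y = ⟪b (e x), euclideanEnd n M (b (e y))⟫_ℂ := by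
    intro M x y
    simp only [PiLp.inner_apply, RCLike.inner_apply, euclideanEnd_apply, mul_assoc,
      Matrix.mul_apply (M := U), Matrix.mul_apply (M := M), Matrix.star_apply, U, Matrix.of_apply,
      star_star]
    exact Finset.sum_congr rfl fun i _ => mul_comm _ _
  have hmem : ∀ M, M ∈ 𝒱 ↔ ∃ B : ∀ i, Matrix (Fin (q i)) (Fin (q i)) ℂ,
      (Matrix.blockDiagonal' (fun i =>
        B i ⊗ₖ (1 : Matrix (Fin (k i)) (Fin (k i)) ℂ))).submatrix e e = U * M * star U := by
    intro M
    rw [hb]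
    refine exists_congr fun B => ?_
    have hblock : ∀ x i l j, ⟪b x, ∑ l', B i l' l • b ⟨i, l', j⟩⟫_ℂ = Matrix.blockDiagonal'
        (fun i => B i ⊗ₖ (1 : Matrix (Fin (k i)) (Fin (k i)) ℂ)) x ⟨i, l, j⟩ := by
      intro x i l j
      simp only [blockDiagonal'_kronecker_one_apply, inner_sum, inner_smul_right,
        orthonormal_iff_ite.mp b.orthonormal]
    constructor
    · intro h
      ext x y
      rw [hconj, Matrix.submatrix_apply]
      rcases e y with ⟨i, l, j⟩
      rw [h, hblock]
    · intro h i l j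
      refine InnerProductSpace.ext_inner_left_basis b.toBasis fun x => ?_
      rw [OrthonormalBasis.coe_toBasis, hblock]
      have := congrFun (congrFun h (e.symm x)) (e.symm ⟨i, l, j⟩)
      rw [hconj, Matrix.submatrix_apply] at this
      simpa using this.symm
  refine ⟨m, q, k, hq, hk, rfl, U, Matrix.mem_unitaryGroup_iff.mpr hU, e, ?_⟩
  ext N
  constructor
  · rintro ⟨M, hM, rfl⟩
    exact (hmem M).mp hM
  · rintro ⟨B, rfl⟩
    have hN : ∀ N, U * (star U * N * U) * star U = N := fun N => by
      simp only [mul_assoc, hU, mul_one]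
      rw [← mul_assoc U, hU, one_mul]
    exact ⟨_, (hmem _).mpr ⟨B, (hN _).symm⟩, hN _⟩

theorem exists_euclideanEnd_eq {n : ℕ} (f : End ℂ (EuclideanSpace ℂ (Fin n))) :
    ∃ M, ∀ e, euclideanEnd n M e = f e :=
  ⟨(euclideanEnd n).symm f, fun e => by rw [StarAlgEquiv.apply_symm_apply]⟩

theorem euclideanEnd_ext {n : ℕ} {M N : Matrix (Fin n) (Fin n) ℂ}
    (h : ∀ e, euclideanEnd n M e = euclideanEnd n N e) : M = N :=
  (euclideanEnd n).injective (LinearMap.ext h)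

theorem euclideanEnd_mul {n : ℕ} (M N : Matrix (Fin n) (Fin n) ℂ) (e) :
    euclideanEnd n (M * N) e = euclideanEnd n M (euclideanEnd n N e) := by
  rw [map_mul]; rfl

section Action

variable {n : ℕ} {𝒱 : Subalgebra ℂ (Matrix (Fin n) (Fin n) ℂ)} {A : Type*} [Ring A] [Algebra ℂ A]
  [Module A (EuclideanSpace ℂ (Fin n))] [IsScalarTower ℂ A (EuclideanSpace ℂ (Fin n))]

/-- The orthogonal projection onto a submodule commutes with the algebra, so it is module-linear and
its kernel is a complement. -/
theorem isSemisimpleModule_of_reducing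
    (hA : ∀ a : A, ∃ M ∈ 𝒱, ∀ e : EuclideanSpace ℂ (Fin n), a • e = euclideanEnd n M e)
    (hA' : ∀ M ∈ 𝒱, ∃ a : A, ∀ e : EuclideanSpace ℂ (Fin n), a • e = euclideanEnd n M e)
    (hproj : ∀ P : Matrix (Fin n) (Fin n) ℂ, Pᴴ = P → (∀ M ∈ 𝒱, P * M * P = M * P) →
      ∀ M ∈ 𝒱, M * P = P * M) :
    IsSemisimpleModule A (EuclideanSpace ℂ (Fin n)) := by
  refine { exists_isCompl := fun W => ?_ }
  let K : Submodule ℂ (EuclideanSpace ℂ (Fin n)) := W.restrictScalars ℂ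
  obtain ⟨P, hP⟩ := exists_euclideanEnd_eq (K.starProjection : End ℂ (EuclideanSpace ℂ (Fin n)))
  have hmem : ∀ e, euclideanEnd n P e ∈ W := fun e => by
    rw [hP]; exact K.starProjection_apply_mem e
  have hfix : ∀ e ∈ W, euclideanEnd n P e = e := fun e he => by
    rw [hP]; exact Submodule.starProjection_eq_self_iff.mpr he
  have hself : Pᴴ = P := by
    refine euclideanEnd_ext fun e => ext_inner_left ℂ fun x => ?_
    rw [← inner_euclideanEnd, hP, hP]
    exact Submodule.inner_starProjection_left_eq_right K x e
  have hinv : ∀ M ∈ 𝒱, P * M * P = M * P := by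
    intro M hM
    obtain ⟨a, ha⟩ := hA' M hM
    refine euclideanEnd_ext fun e => ?_
    rw [mul_assoc, euclideanEnd_mul P, hfix]
    rw [euclideanEnd_mul, ← ha]
    exact W.smul_mem a (hmem e)
  let f : EuclideanSpace ℂ (Fin n) →ₗ[A] W :=
    { toFun := fun e => ⟨euclideanEnd n P e, hmem e⟩
      map_add' := fun x y => Subtype.ext (map_add _ x y)
      map_smul' := fun a x => by
        obtain ⟨M, hM, ha⟩ := hA a
        refine Subtype.ext ?_
        change euclideanEnd n P (a • x) = a • euclideanEnd n P x
        rw [ha, ha, ← euclideanEnd_mul, ← euclideanEnd_mul, hproj P hself hinv M hM] }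
  exact ⟨_, LinearMap.isCompl_of_proj (f := f) fun x => Subtype.ext (hfix x x.2)⟩

/-- If `T` is in the commutant, so is `T*`; taking adjoints, `M*` commutes with `T`. The double
commutant property then puts `M*` in the algebra. -/
theorem exists_adjoint_smul [IsSemisimpleModule A (EuclideanSpace ℂ (Fin n))]
    (hA : ∀ a : A, ∃ M ∈ 𝒱, ∀ e : EuclideanSpace ℂ (Fin n), a • e = euclideanEnd n M e)
    (hA' : ∀ M ∈ 𝒱, ∃ a : A, ∀ e : EuclideanSpace ℂ (Fin n), a • e = euclideanEnd n M e)
    (hcomm : ∀ T, (∀ M ∈ 𝒱, M * T = T * M) → ∀ M ∈ 𝒱, M * Tᴴ = Tᴴ * M) (a : A) :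
    ∃ b : A, ∀ x y : EuclideanSpace ℂ (Fin n), ⟪a • x, y⟫_ℂ = ⟪x, b • y⟫_ℂ := by
  obtain ⟨M, hM, ha⟩ := hA a
  obtain ⟨b, hb⟩ := exists_smul_eq_of_forall_commute (A := A) (euclideanEnd n Mᴴ) (by
    intro C e
    obtain ⟨T, hT⟩ := exists_euclideanEnd_eq (C.restrictScalars ℂ)
    simp only [LinearMap.restrictScalars_apply] at hT
    have h1 : ∀ M ∈ 𝒱, M * T = T * M := by
      intro M hM
      obtain ⟨a, ha⟩ := hA' M hM
      refine euclideanEnd_ext fun e => ?_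
      rw [euclideanEnd_mul, euclideanEnd_mul, ← ha, ← ha, hT, hT, map_smul]
    have h2 := congrArg Matrix.conjTranspose (hcomm T h1 M hM)
    rw [Matrix.conjTranspose_mul, Matrix.conjTranspose_mul, Matrix.conjTranspose_conjTranspose]
      at h2
    rw [← hT, ← hT, ← euclideanEnd_mul, ← euclideanEnd_mul, h2])
  exact ⟨b, fun x y => by rw [ha, inner_euclideanEnd, ← hb]⟩

end Action

/-- An algebra of matrices whose commutant is closed under adjoints, and all of whose invariant
subspaces are reducing, has a type. -/
theorem exists_isOfType {n : ℕ} {𝒱 : Subalgebra ℂ (Matrix (Fin n) (Fin n) ℂ)}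
    (hcomm : ∀ T, (∀ M ∈ 𝒱, M * T = T * M) → ∀ M ∈ 𝒱, M * Tᴴ = Tᴴ * M)
    (hproj : ∀ P : Matrix (Fin n) (Fin n) ℂ, Pᴴ = P → (∀ M ∈ 𝒱, P * M * P = M * P) →
      ∀ M ∈ 𝒱, M * P = P * M) :
    ∃ τ, IsOfType 𝒱 τ := by
  let 𝒜 : Subalgebra ℂ (End ℂ (EuclideanSpace ℂ (Fin n))) :=
    𝒱.map (euclideanEnd n : Matrix (Fin n) (Fin n) ℂ →ₐ[ℂ] End ℂ (EuclideanSpace ℂ (Fin n)))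
  have hA : ∀ (a : 𝒜), ∃ M ∈ 𝒱, ∀ e : EuclideanSpace ℂ (Fin n), a • e = euclideanEnd n M e := by
    rintro ⟨_, M, hM, rfl⟩
    exact ⟨M, hM, fun _ => rfl⟩
  have hA' : ∀ M ∈ 𝒱, ∃ a : 𝒜, ∀ e : EuclideanSpace ℂ (Fin n), a • e = euclideanEnd n M e :=
    fun M hM => ⟨⟨euclideanEnd n M, M, hM, rfl⟩, fun _ => rfl⟩
  have := isSemisimpleModule_of_reducing (A := 𝒜) hA hA' hproj
  obtain ⟨m, q, k, hq, hk, b, hb⟩ :=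
    exists_adapted_orthonormalBasis (exists_adjoint_smul (A := 𝒜) hA hA' hcomm)
  refine ⟨_, isOfType_of_adapted_orthonormalBasis hq hk b fun M => Iff.trans ⟨fun hM => ?_, ?_⟩
    (hb (euclideanEnd n M))⟩
  · obtain ⟨a, ha⟩ := hA' M hM
    exact ⟨a, fun e => (ha e).symm⟩
  · rintro ⟨a, ha⟩
    obtain ⟨M', hM', ha'⟩ := hA a
    have : M = M' := euclideanEnd_ext fun e => by rw [ha, ha']
    exact this ▸ hM'

end MatrixAlgebra

/-! ### Refinement of multisets as a map between index sets. -/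

section Refinement

variable {P Q : Type*} [Fintype P] [Fintype Q]

theorem exists_equiv_of_map_univ_eq {β : Type*} {f : P → β} {g : Q → β}
    (h : Finset.univ.val.map f = Finset.univ.val.map g) : ∃ σ : P ≃ Q, ∀ p, g (σ p) = f p := by
  classical
  have hcard : ∀ b, Fintype.card {p // f p = b} = Fintype.card {p // g p = b} := by
    intro b
    have := congrArg (Multiset.count b) h
    simp only [Multiset.count_map, eq_comm (a := b), ← Finset.filter_val, Finset.card_val] at this
    rw [Fintype.card_subtype, Fintype.card_subtype, this]
  exact ⟨Equiv.ofFiberEquiv fun b => Fintype.equivOfCardEq (hcard b), fun p =>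
    Equiv.ofFiberEquiv_map _ p⟩

/-- A `0`-`1` matrix whose columns sum to `1` is the indicator matrix of a map. -/
theorem isRefinement_iff {k l : ℕ} (v : Fin k → ℕ) (w : Fin l → ℕ) :
    IsRefinement v w ↔ ∃ f : Fin k → Fin l, ∀ b, ∑ p with f p = b, v p = w b := by
  constructor
  · rintro ⟨A, h01, hcol, rfl⟩
    have hex : ∀ j, ∃ i, A i j = 1 := fun j => by
      by_contra! h
      have : ∑ i, A i j = 0 := Finset.sum_eq_zero fun i _ => (h01 i j).resolve_right (h i)
      rw [hcol] at this
      exact one_ne_zero this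
    choose f hf using hex
    have hA : ∀ i j, A i j = if f j = i then 1 else 0 := by
      intro i j
      split_ifs with h
      · rw [← h, hf]
      · refine (h01 i j).resolve_right fun h1 => ?_
        have h2 : A (f j) j + A i j ≤ ∑ i, A i j :=
          Finset.add_le_sum (f := fun i => A i j) (fun _ _ => Nat.zero_le _)
            (Finset.mem_univ _) (Finset.mem_univ _) h
        rw [hcol, hf, h1] at h2
        omega
    refine ⟨f, fun b => ?_⟩
    simp [Matrix.mulVec, dotProduct, hA, Finset.sum_filter]
  · rintro ⟨f, hf⟩
    refine ⟨Matrix.of fun i j => if f j = i then 1 else 0, fun i j => ?_, fun j => ?_, ?_⟩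
    · rw [Matrix.of_apply]; split_ifs <;> simp
    · simp
    · ext b
      rw [← hf]
      simp [Matrix.mulVec, dotProduct, Finset.sum_filter]

theorem refines_map_iff [DecidableEq Q] (v : P → ℕ) (w : Q → ℕ) :
    Refines (Finset.univ.val.map v) (Finset.univ.val.map w) ↔
      ∃ f : P → Q, ∀ b, ∑ p with f p = b, v p = w b := by
  constructor
  · rintro ⟨k, l, v', w', hv, hw, h⟩
    obtain ⟨f, hf⟩ := (isRefinement_iff v' w').mp h
    obtain ⟨σ, hσ⟩ := exists_equiv_of_map_univ_eq hv
    obtain ⟨π, hπ⟩ := exists_equiv_of_map_univ_eq hw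
    refine ⟨fun p => π.symm (f (σ p)), fun b => ?_⟩
    rw [← hπ, ← hf, Finset.sum_filter, Finset.sum_filter]
    refine Fintype.sum_equiv σ _ _ fun p => ?_
    simp only [hσ, Equiv.symm_apply_eq]
  · rintro ⟨f, hf⟩
    let σ := Fintype.equivFin P
    let π := Fintype.equivFin Q
    refine ⟨_, _, v ∘ σ.symm, w ∘ π.symm, ?_, ?_, (isRefinement_iff _ _).mpr
      ⟨fun p => π (f (σ.symm p)), fun b => ?_⟩⟩
    · rw [← Multiset.map_map]
      congr 1
      exact (congrArg Finset.val (Finset.map_univ_equiv σ.symm)).symm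
    · rw [← Multiset.map_map]
      congr 1
      exact (congrArg Finset.val (Finset.map_univ_equiv π.symm)).symm
    · rw [Function.comp_apply, ← hf, Finset.sum_filter, Finset.sum_filter]
      refine Fintype.sum_equiv σ.symm _ _ fun p => ?_
      simp only [Function.comp_apply, Equiv.eq_symm_apply]

/-- Positivity makes both index maps surjective, so they are bijective and every fibre sum has one
term. -/
theorem eq_of_refines_of_refines {v : P → ℕ} {w : Q → ℕ} (hv : ∀ p, 0 < v p) (hw : ∀ p, 0 < w p)
    (h : Refines (Finset.univ.val.map v) (Finset.univ.val.map w))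
    (h' : Refines (Finset.univ.val.map w) (Finset.univ.val.map v)) :
    Finset.univ.val.map v = Finset.univ.val.map w := by
  classical
  obtain ⟨f, hf⟩ := (refines_map_iff v w).mp h
  obtain ⟨g, hg⟩ := (refines_map_iff w v).mp h'
  have hfs : Function.Surjective f := fun b => by
    by_contra! hb
    have := hw b
    rw [← hf, Finset.filter_eq_empty_iff.mpr (fun p _ => hb p)] at this
    simp at this
  have hgs : Function.Surjective g := fun b => by
    by_contra! hb
    have := hv b
    rw [← hg, Finset.filter_eq_empty_iff.mpr (fun p _ => hb p)] at this
    simp at this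
  have hfb : Function.Bijective f := (Fintype.bijective_iff_surjective_and_card f).mpr
    ⟨hfs, le_antisymm (Fintype.card_le_of_surjective g hgs) (Fintype.card_le_of_surjective f hfs)⟩
  have hvw : v = w ∘ Equiv.ofBijective f hfb := by
    ext p
    rw [Function.comp_apply, Equiv.ofBijective_apply, ← hf]
    rw [Finset.sum_filter, Finset.sum_eq_single p (fun p' _ h => if_neg fun h' => h (hfb.1 h'))
      (fun h => (h (Finset.mem_univ _)).elim), if_pos rfl]
  rw [hvw, ← Multiset.map_map]
  congr 1
  exact congrArg Finset.val (Finset.map_univ_equiv _)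

theorem multiplicities_eq_map_univ {n : ℕ} (x : Fin n → ℝ) :
    multiplicities x = (Finset.univ : Finset {a // a ∈ Finset.univ.image x}).val.map
      (fun a => (Finset.univ.filter (fun i => x i = a.1)).card) := by
  rw [multiplicities, Finset.univ_eq_attach, Finset.attach_val]
  conv_lhs => rw [← Multiset.attach_map_val (Finset.image x Finset.univ).val, Multiset.map_map]
  rfl

/-- The index map may take arbitrary real values: positivity of `v` forces them to be entries of
`x`. -/
theorem refines_multiplicities_iff {n : ℕ} {v : P → ℕ} (hv : ∀ p, 0 < v p) (x : Fin n → ℝ) :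
    Refines (Finset.univ.val.map v) (multiplicities x) ↔
      ∃ c : P → ℝ, ∀ a, ∑ p with c p = a, v p = (Finset.univ.filter (fun i => x i = a)).card := by
  rw [multiplicities_eq_map_univ, refines_map_iff]
  constructor
  · rintro ⟨f, hf⟩
    refine ⟨fun p => f p, fun a => ?_⟩
    by_cases ha : a ∈ Finset.univ.image x
    · rw [← hf ⟨a, ha⟩]
      simp only [Subtype.ext_iff]
    · rw [Finset.filter_eq_empty_iff.mpr fun i _ h =>
          ha (Finset.mem_image.mpr ⟨i, Finset.mem_univ _, h⟩), Finset.card_empty]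
      refine Finset.sum_eq_zero fun p hp => (ha ?_).elim
      rw [← (Finset.mem_filter.mp hp).2]
      exact (f p).2
  · rintro ⟨c, hc⟩
    have hmem : ∀ p, c p ∈ Finset.univ.image x := by
      intro p
      by_contra h
      have h0 := hc (c p)
      rw [Finset.filter_eq_empty_iff (p := fun i => x i = c p) |>.mpr fun i _ h' =>
          h (Finset.mem_image.mpr ⟨i, Finset.mem_univ _, h'⟩), Finset.card_empty,
        Finset.sum_eq_zero_iff] at h0
      exact (hv p).ne' (h0 p (by simp))
    refine ⟨fun p => ⟨c p, hmem p⟩, fun b => ?_⟩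
    rw [← hc]
    simp only [Subtype.ext_iff]

theorem sum_replicate_eq_map_univ {m : ℕ} (q k : Fin m → ℕ) :
    ∑ i, Multiset.replicate (k i) (q i) =
      (Finset.univ : Finset (Σ i, Fin (k i))).val.map (fun p => q p.1) := by
  have : ∀ s : Multiset (Σ i, Fin (k i)), s.map (fun p => q p.1) =
      (s.map fun p => ({q p.1} : Multiset ℕ)).sum := fun s => by
    rw [← Multiset.sum_map_singleton (s.map _), Multiset.map_map]; rfl
  rw [this]
  change _ = ∑ p : Σ i, Fin (k i), ({q p.1} : Multiset ℕ)
  rw [Fintype.sum_sigma]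
  simp [Multiset.nsmul_singleton]

end Refinement

/-! ### Hermitian spectra in the commutant. -/

section Commutant

variable {m : ℕ} {q k : Fin m → ℕ}

theorem blockDiagonal'_kronecker_one_row_apply
    (B : ∀ i, Matrix (Fin (q i)) (Fin (q i)) ℂ) (i : Fin m) (l : Fin (q i)) (j : Fin (k i))
    (p : Σ i, Fin (q i) × Fin (k i)) :
    Matrix.blockDiagonal' (fun i => B i ⊗ₖ (1 : Matrix (Fin (k i)) (Fin (k i)) ℂ)) ⟨i, l, j⟩ p =
      ∑ l', B i l l' * if p = ⟨i, l', j⟩ then 1 else 0 := by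
  obtain ⟨i', l'', j'⟩ := p
  by_cases hi : i' = i
  · subst hi
    rw [Matrix.blockDiagonal'_apply_eq, Matrix.kroneckerMap_apply, Matrix.one_apply]
    by_cases hj : j = j'
    · simp [hj]
    · simp [hj, Ne.symm hj]
  · rw [Matrix.blockDiagonal'_apply_ne _ _ _ (Ne.symm hi)]
    refine (Finset.sum_eq_zero fun l' _ => ?_).symm
    rw [if_neg (fun h => hi (congrArg Sigma.fst h)), mul_zero]

/-- The commutant of `⨁ᵢ ℂ^{qᵢ × qᵢ} ⊗ 1` consists of matrices in `⨁ᵢ 1 ⊗ ℂ^{kᵢ × kᵢ}`. -/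
theorem eq_blockDiagonal'_of_commute (hq : ∀ i, 0 < q i)
    {R : Matrix (Σ i, Fin (q i) × Fin (k i)) (Σ i, Fin (q i) × Fin (k i)) ℂ}
    (hR : ∀ B : ∀ i, Matrix (Fin (q i)) (Fin (q i)) ℂ,
      Matrix.blockDiagonal' (fun i => B i ⊗ₖ (1 : Matrix (Fin (k i)) (Fin (k i)) ℂ)) * R =
        R * Matrix.blockDiagonal' (fun i => B i ⊗ₖ (1 : Matrix (Fin (k i)) (Fin (k i)) ℂ))) :
    R = Matrix.blockDiagonal' (fun i => (1 : Matrix (Fin (q i)) (Fin (q i)) ℂ) ⊗ₖ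
      Matrix.of fun j j' => R ⟨i, ⟨0, hq i⟩, j⟩ ⟨i, ⟨0, hq i⟩, j'⟩) := by
  have key : ∀ (B : ∀ i, Matrix (Fin (q i)) (Fin (q i)) ℂ) i₀ l₀ j₀ i l j,
      ∑ l', B i₀ l₀ l' * R ⟨i₀, l', j₀⟩ ⟨i, l, j⟩ = ∑ l', B i l' l * R ⟨i₀, l₀, j₀⟩ ⟨i, l', j⟩ := by
    intro B i₀ l₀ j₀ i l j
    have h := congrFun (congrFun (hR B) ⟨i₀, l₀, j₀⟩) ⟨i, l, j⟩
    simp only [Matrix.mul_apply, blockDiagonal'_kronecker_one_row_apply,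
      blockDiagonal'_kronecker_one_apply, Finset.sum_mul, Finset.mul_sum] at h
    rw [Finset.sum_comm, Finset.sum_comm (s := Finset.univ (α := Σ i, Fin (q i) × Fin (k i)))] at h
    simpa [mul_comm] using h
  ext ⟨i₀, l₀, j₀⟩ ⟨i, l, j⟩
  -- Testing against the matrix unit `E_{l,0}` in block `i` reduces each entry to the corner `l =
  -- 0`.
  have h := key (Pi.single i (Matrix.single l ⟨0, hq i⟩ 1)) i₀ l₀ j₀ i ⟨0, hq i⟩ j
  by_cases hi : i₀ = i
  · subst hi
    rw [Matrix.blockDiagonal'_apply_eq, Matrix.kroneckerMap_apply, Matrix.one_apply]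
    simp only [Pi.single_eq_same, Matrix.single_apply] at h
    by_cases hl : l = l₀
    · subst hl; simpa using h.symm
    · rw [if_neg (Ne.symm hl), zero_mul]
      simpa [hl] using h.symm
  · rw [Matrix.blockDiagonal'_apply_ne _ _ _ hi]
    simp only [Pi.single_eq_same, Pi.single_eq_of_ne hi, Matrix.single_apply, Matrix.zero_apply]
      at h
    simpa using h.symm

theorem charpoly_unitary_conj {ι : Type*} [Fintype ι] [DecidableEq ι] {U : Matrix ι ι ℂ}
    (hU : U ∈ Matrix.unitaryGroup ι ℂ) (M : Matrix ι ι ℂ) :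
    (U * M * star U).charpoly = M.charpoly := by
  rw [Matrix.charpoly_mul_comm, ← mul_assoc, Matrix.mem_unitaryGroup_iff'.mp hU, one_mul]

theorem roots_charpoly_diagonal_ofReal {ι : Type*} [Fintype ι] [DecidableEq ι] (x : ι → ℝ) :
    (Matrix.diagonal fun i => (x i : ℂ)).charpoly.roots =
      (Finset.univ.val.map x).map ((↑) : ℝ → ℂ) := by
  rw [Matrix.charpoly_diagonal, ← Polynomial.roots_multiset_prod_X_sub_C (Multiset.map _ _),
    Multiset.map_map, Multiset.map_map]
  rfl

theorem map_univ_eq_of_charpoly_diagonal_eq {ι κ : Type*} [Fintype ι] [DecidableEq ι] [Fintype κ]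
    [DecidableEq κ] {x : ι → ℝ} {y : κ → ℝ}
    (h : (Matrix.diagonal fun i => (x i : ℂ)).charpoly =
      (Matrix.diagonal fun i => (y i : ℂ)).charpoly) :
    Finset.univ.val.map x = Finset.univ.val.map y := by
  have := congrArg Polynomial.roots h
  rw [roots_charpoly_diagonal_ofReal, roots_charpoly_diagonal_ofReal] at this
  exact Multiset.map_injective Complex.ofReal_injective this

/-- Diagonalizing each block `1 ⊗ C i` unitarily repeats every eigenvalue of `C i` exactly `q i`
times. -/
theorem exists_charpoly_eq_of_commute (hq : ∀ i, 0 < q i)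
    {R : Matrix (Σ i, Fin (q i) × Fin (k i)) (Σ i, Fin (q i) × Fin (k i)) ℂ}
    (hR : ∀ B : ∀ i, Matrix (Fin (q i)) (Fin (q i)) ℂ,
      Matrix.blockDiagonal' (fun i => B i ⊗ₖ (1 : Matrix (Fin (k i)) (Fin (k i)) ℂ)) * R =
        R * Matrix.blockDiagonal' (fun i => B i ⊗ₖ (1 : Matrix (Fin (k i)) (Fin (k i)) ℂ)))
    (hH : R.IsHermitian) :
    ∃ c : (Σ i, Fin (k i)) → ℝ, R.charpoly =
      (Matrix.diagonal fun p : Σ i, Fin (q i) × Fin (k i) =>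
        (c ⟨p.1, p.2.2⟩ : ℂ)).charpoly := by
  let C : ∀ i, Matrix (Fin (k i)) (Fin (k i)) ℂ := fun i =>
    Matrix.of fun j j' => R ⟨i, ⟨0, hq i⟩, j⟩ ⟨i, ⟨0, hq i⟩, j'⟩
  have hRC : R = Matrix.blockDiagonal' (fun i => (1 : Matrix (Fin (q i)) (Fin (q i)) ℂ) ⊗ₖ C i) :=
    eq_blockDiagonal'_of_commute hq hR
  have hC : ∀ i, (C i).IsHermitian := fun i => by
    ext j j'
    exact hH.apply _ _
  let u : ∀ i, Matrix (Fin (k i)) (Fin (k i)) ℂ := fun i => (hC i).eigenvectorUnitary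
  have hu : ∀ i, u i ∈ Matrix.unitaryGroup (Fin (k i)) ℂ := fun i => (hC i).eigenvectorUnitary.2
  let D : ∀ i, Matrix (Fin (k i)) (Fin (k i)) ℂ :=
    fun i => Matrix.diagonal fun j => ((hC i).eigenvalues j : ℂ)
  have hspec : ∀ i, C i = u i * D i * star (u i) := fun i => (hC i).spectral_theorem
  let Y := Matrix.blockDiagonal' (fun i => (1 : Matrix (Fin (q i)) (Fin (q i)) ℂ) ⊗ₖ u i)
  have hYs : star Y =
      Matrix.blockDiagonal' (fun i => (1 : Matrix (Fin (q i)) (Fin (q i)) ℂ) ⊗ₖ star (u i)) := by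
    simp only [Y, Matrix.star_eq_conjTranspose, Matrix.blockDiagonal'_conjTranspose,
      Matrix.conjTranspose_kronecker, Matrix.conjTranspose_one]
  have hY : Y ∈ Matrix.unitaryGroup _ ℂ := by
    rw [Matrix.mem_unitaryGroup_iff, hYs]
    simp only [Y, ← Matrix.blockDiagonal'_mul, ← Matrix.mul_kronecker_mul,
      Matrix.mem_unitaryGroup_iff.mp (hu _), one_mul, Matrix.one_kronecker_one]
    exact Matrix.blockDiagonal'_one
  refine ⟨fun p => (hC p.1).eigenvalues p.2, ?_⟩
  have hD : (Matrix.diagonal fun p : Σ i, Fin (q i) × Fin (k i) =>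
      ((hC p.1).eigenvalues p.2.2 : ℂ)) =
      Matrix.blockDiagonal' (fun i => (1 : Matrix (Fin (q i)) (Fin (q i)) ℂ) ⊗ₖ D i) := by
    simp only [D, ← Matrix.diagonal_one, Matrix.diagonal_kronecker_diagonal, one_mul,
      Matrix.blockDiagonal'_diagonal]
  have hRY : R = Y * (Matrix.diagonal fun p : Σ i, Fin (q i) × Fin (k i) =>
      ((hC p.1).eigenvalues p.2.2 : ℂ)) * star Y := by
    rw [hRC, hD, hYs]
    simp only [Y, ← Matrix.blockDiagonal'_mul, ← Matrix.mul_kronecker_mul, one_mul, ← hspec]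
  rw [hRY, charpoly_unitary_conj hY]

theorem sum_eq_card_iff_map_univ_eq {n : ℕ} (x : Fin n → ℝ) (c : (Σ i, Fin (k i)) → ℝ) :
    (∀ a, ∑ p with c p = a, q p.1 = (Finset.univ.filter (fun i => x i = a)).card) ↔
      Finset.univ.val.map x = Finset.univ.val.map
        fun p : Σ i, Fin (q i) × Fin (k i) => c ⟨p.1, p.2.2⟩ := by
  rw [Multiset.ext]
  refine forall_congr' fun a => ?_
  simp only [Multiset.count_map, eq_comm (a := a), ← Finset.filter_val, Finset.card_val]
  rw [eq_comm]
  have : ∑ p with c p = a, q p.1 = (Finset.univ.filter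
      fun p : Σ i, Fin (q i) × Fin (k i) => c ⟨p.1, p.2.2⟩ = a).card := by
    rw [Finset.sum_filter, Finset.card_filter, Fintype.sum_sigma, Fintype.sum_sigma]
    refine Finset.sum_congr rfl fun i _ => ?_
    rw [Fintype.sum_prod_type, Finset.sum_comm]
    refine Finset.sum_congr rfl fun j _ => ?_
    split_ifs <;> simp
  rw [this]

/-- A real spectrum occurs in the commutant of an algebra of type `τ` if and only if `τ` refines
its multiplicities. -/
theorem exists_commute_conj_diagonal_iff {n : ℕ} {𝒱 : Subalgebra ℂ (Matrix (Fin n) (Fin n) ℂ)}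
    {τ : Multiset ℕ} (h : IsOfType 𝒱 τ) (x : Fin n → ℝ) :
    (∃ U ∈ Matrix.unitaryGroup (Fin n) ℂ, ∀ M ∈ 𝒱,
      M * (U * Matrix.diagonal (fun j => (x j : ℂ)) * star U) =
        U * Matrix.diagonal (fun j => (x j : ℂ)) * star U * M) ↔ Refines τ (multiplicities x) := by
  obtain ⟨m, q, k, hq, hk, rfl, W, hW, e, hWe⟩ := h
  rw [sum_replicate_eq_map_univ,
    refines_multiplicities_iff (v := fun p : Σ i, Fin (k i) => q p.1) (fun p => hq p.1)]
  simp only [sum_eq_card_iff_map_univ_eq]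
  have hW2 := Matrix.mem_unitaryGroup_iff'.mp hW
  constructor
  · rintro ⟨U, hU, hcomm⟩
    let ρ := U * Matrix.diagonal (fun j => (x j : ℂ)) * star U
    have hρ : ρᴴ = ρ := by
      simp [ρ, Matrix.star_eq_conjTranspose, Matrix.diagonal_conjTranspose, mul_assoc,
        Pi.star_def]
    let R := (W * ρ * star W).submatrix e.symm e.symm
    obtain ⟨c, hc⟩ := exists_charpoly_eq_of_commute (R := R) hq (fun B => by
      obtain ⟨M, hM, hMB⟩ := hWe.ge ⟨B, rfl⟩
      have hB : Matrix.blockDiagonal' (fun i => B i ⊗ₖ (1 : Matrix (Fin (k i)) (Fin (k i)) ℂ)) =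
          (W * M * star W).submatrix e.symm e.symm := by
        simp only at hMB
        rw [hMB]; ext; simp
      have hconj : ∀ A B : Matrix (Fin n) (Fin n) ℂ,
          W * A * star W * (W * B * star W) = W * (A * B) * star W := fun A B => by
        simp only [mul_assoc, ← mul_assoc (star W) W, hW2, one_mul]
      rw [hB, Matrix.submatrix_mul_equiv, Matrix.submatrix_mul_equiv, hconj, hconj, hcomm M hM])
      (by
        ext a b
        simp only [R, Matrix.conjTranspose_submatrix, Matrix.conjTranspose_mul,
          Matrix.star_eq_conjTranspose, Matrix.conjTranspose_conjTranspose, hρ, mul_assoc])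
    refine ⟨c, map_univ_eq_of_charpoly_diagonal_eq ?_⟩
    rw [← hc, ← charpoly_unitary_conj hU, ← charpoly_unitary_conj hW]
    exact (Matrix.charpoly_reindex e _).symm
  · rintro ⟨c, hc⟩
    obtain ⟨σ, hσ⟩ := exists_equiv_of_map_univ_eq hc
    let π := σ.trans e.symm
    -- A permutation of `x` that is constant along each factor `ℂ^{qᵢ}`, so that its diagonal matrix
    -- commutes with all blocks.
    let d : Fin n → ℝ := fun y => c ⟨(e y).1, (e y).2.2⟩
    have hd : (Matrix.diagonal fun j => (x j : ℂ)) =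
        (Matrix.diagonal fun j => (d j : ℂ)).submatrix π π := by
      rw [Matrix.submatrix_diagonal_equiv]
      congr 1
      ext j
      simp only [d, π, Function.comp_apply, Equiv.trans_apply]
      rw [e.apply_symm_apply, hσ]
    have hs : star ((star W).submatrix id π) = W.submatrix π id := by
      simp [Matrix.star_eq_conjTranspose]
    have hρ : (star W).submatrix id π * Matrix.diagonal (fun j => (x j : ℂ)) *
        star ((star W).submatrix id π) = star W * (Matrix.diagonal fun j => (d j : ℂ)) * W := by
      rw [hs, hd, Matrix.submatrix_mul_equiv, Matrix.submatrix_mul_equiv, Matrix.submatrix_id_id]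
    refine ⟨(star W).submatrix id π, ?_, fun M hM => ?_⟩
    · rw [Matrix.mem_unitaryGroup_iff, hs, Matrix.submatrix_mul_equiv, hW2,
        Matrix.submatrix_id_id]
    · rw [hρ]
      obtain ⟨B, hB⟩ := hWe.le ⟨M, hM, rfl⟩
      simp only at hB
      have hcomm : (W * M * star W) * (Matrix.diagonal fun j => (d j : ℂ)) =
          (Matrix.diagonal fun j => (d j : ℂ)) * (W * M * star W) := by
        rw [← hB]
        ext a b
        rw [Matrix.mul_diagonal, Matrix.diagonal_mul, Matrix.submatrix_apply]
        simp only [d]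
        rcases e a with ⟨i, l, j⟩
        rcases e b with ⟨i', l', j'⟩
        by_cases hi : i = i'
        · subst hi
          rw [Matrix.blockDiagonal'_apply_eq, Matrix.kroneckerMap_apply, Matrix.one_apply]
          by_cases hj : j = j'
          · subst hj; exact mul_comm _ _
          · simp [hj]
        · rw [Matrix.blockDiagonal'_apply_ne _ _ _ hi]; simp
      have h1 := congrArg (fun A => star W * A * W) hcomm
      simp only [mul_assoc, ← mul_assoc (star W) W, hW2, one_mul, mul_one] at h1 ⊢
      simpa only [mul_assoc, ← mul_assoc (star W) W, hW2, one_mul, mul_one] using h1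

end Commutant

/-- A spectrum whose multiplicities are exactly `τ` occurs in the commutant, so any other type
refines `τ`; the roles are symmetric. -/
theorem isOfType_unique {n : ℕ} {𝒱 : Subalgebra ℂ (Matrix (Fin n) (Fin n) ℂ)}
    {τ τ' : Multiset ℕ} (h : IsOfType 𝒱 τ) (h' : IsOfType 𝒱 τ') : τ = τ' := by
  have key : ∀ {τ τ' : Multiset ℕ}, IsOfType 𝒱 τ → IsOfType 𝒱 τ' → Refines τ' τ := by
    intro τ τ' h h'
    obtain ⟨x, hx, hrefl⟩ : ∃ x : Fin n → ℝ, multiplicities x = τ ∧ Refines τ τ := by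
      obtain ⟨m, q, k, hq, hk, rfl, W, hW, e, hWe⟩ := h
      -- Distinct reals for distinct blocks make the multiplicities equal to the block sizes.
      let c : (Σ i, Fin (k i)) ↪ ℝ := (Fintype.equivFin _).toEmbedding.trans
        (Fin.valEmbedding.trans Nat.castEmbedding)
      let x : Fin n → ℝ := fun y => c ⟨(e y).1, (e y).2.2⟩
      refine ⟨x, ?_, by
        rw [sum_replicate_eq_map_univ, refines_map_iff]
        exact ⟨id, fun b => by simp [Finset.filter_eq']⟩⟩
      have himg : Finset.univ.image x = Finset.univ.map c := by
        ext a
        simp only [Finset.mem_image, Finset.mem_map, Finset.mem_univ, true_and]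
        constructor
        · rintro ⟨y, rfl⟩; exact ⟨_, rfl⟩
        · rintro ⟨⟨i, j⟩, rfl⟩
          refine ⟨e.symm ⟨i, ⟨0, hq i⟩, j⟩, ?_⟩
          simp only [x]
          rw [e.apply_symm_apply]
      have hx := (sum_eq_card_iff_map_univ_eq (q := q) x c).mpr (by
        have : x = (fun p : Σ i, Fin (q i) × Fin (k i) => c ⟨p.1, p.2.2⟩) ∘ e := rfl
        rw [this, ← Multiset.map_map]
        congr 1
        exact congrArg Finset.val (Finset.map_univ_equiv e))
      rw [multiplicities, himg, sum_replicate_eq_map_univ, Finset.map_val, Multiset.map_map]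
      refine Multiset.map_congr rfl fun p _ => ?_
      rw [Function.comp_apply, ← hx]
      simp [c.injective.eq_iff, Finset.filter_eq']
    subst hx
    exact (exists_commute_conj_diagonal_iff h' x).mp
      ((exists_commute_conj_diagonal_iff h x).mpr hrefl)
  have h1 := key h h'
  have h2 := key h' h
  obtain ⟨m, q, k, hq, -, rfl, -⟩ := h
  obtain ⟨m', q', k', hq', -, rfl, -⟩ := h'
  rw [sum_replicate_eq_map_univ, sum_replicate_eq_map_univ] at *
  exact eq_of_refines_of_refines (fun p => hq p.1) (fun p => hq' p.1) h2 h1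

/-! ### Unitality, purity decay and stabilizable points. -/

section Dissipation

open Matrix

variable {n r : ℕ} {H : Matrix (Fin n) (Fin n) ℂ} {V : Fin r → Matrix (Fin n) (Fin n) ℂ}

theorem sum_conjTranspose_mul_self_eq (h : IsUnital (lindbladOperator H V)) :
    ∑ k, (V k)ᴴ * V k = ∑ k, V k * (V k)ᴴ := by
  have h' : Complex.I • (H * 1 - 1 * H) + ∑ k, ((1 / 2 : ℂ) •
      ((V k)ᴴ * V k * 1 + 1 * ((V k)ᴴ * V k)) - V k * 1 * (V k)ᴴ) = 0 := h
  rw [← sub_eq_zero, ← Finset.sum_sub_distrib, ← h']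
  simp only [mul_one, one_mul, sub_self, smul_zero, zero_add]
  refine Finset.sum_congr rfl fun k _ => ?_
  rw [← two_smul ℂ, smul_smul]
  norm_num

theorem sum_trace_conjTranspose_mul_self_mul (h : IsUnital (lindbladOperator H V))
    (A : Matrix (Fin n) (Fin n) ℂ) :
    ∑ k, trace ((V k)ᴴ * V k * A) = ∑ k, trace (V k * (V k)ᴴ * A) := by
  rw [← trace_sum, ← trace_sum, ← Finset.sum_mul, ← Finset.sum_mul,
    sum_conjTranspose_mul_self_eq h]

open scoped ComplexOrder in
theorem trace_conjTranspose_mul_self_nonneg (D : Matrix (Fin n) (Fin n) ℂ) :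
    0 ≤ trace (Dᴴ * D) :=
  (posSemidef_conjTranspose_mul_self D).trace_nonneg

open scoped ComplexOrder in
theorem eq_zero_of_sum_trace_eq_zero {D : Fin r → Matrix (Fin n) (Fin n) ℂ}
    (h : ∑ k, trace ((D k)ᴴ * D k) = 0) (k : Fin r) : D k = 0 :=
  trace_conjTranspose_mul_self_eq_zero_iff.mp <| (Finset.sum_eq_zero_iff_of_nonneg
    fun k _ => trace_conjTranspose_mul_self_nonneg (D k)).mp h k (Finset.mem_univ k)

theorem commute_of_mem_relaxationAlgebra {T : Matrix (Fin n) (Fin n) ℂ}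
    (h : ∀ k, V k * T = T * V k) : ∀ M ∈ relaxationAlgebra V, M * T = T * M := by
  have hle : relaxationAlgebra V ≤ Subalgebra.centralizer ℂ {T} := by
    refine Algebra.adjoin_le ?_
    rintro _ ⟨k, rfl⟩
    exact Subalgebra.mem_centralizer_iff ℂ |>.mpr fun g hg => by
      rw [Set.mem_singleton_iff.mp hg, h]
  exact fun M hM => ((Subalgebra.mem_centralizer_iff ℂ).mp (hle hM) T rfl).symm

theorem mem_relaxationAlgebra (V : Fin r → Matrix (Fin n) (Fin n) ℂ) (k : Fin r) :
    V k ∈ relaxationAlgebra V :=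
  Algebra.subset_adjoin ⟨k, rfl⟩

/-- The commutant of the Lindblad terms of a unital system is closed under adjoints. -/
theorem conjTranspose_commute (h : IsUnital (lindbladOperator H V))
    {T : Matrix (Fin n) (Fin n) ℂ} (hT : ∀ k, V k * T = T * V k) (k : Fin r) :
    V k * Tᴴ = Tᴴ * V k := by
  refine sub_eq_zero.mp (eq_zero_of_sum_trace_eq_zero (D := fun k => V k * Tᴴ - Tᴴ * V k) ?_ k)
  -- Since `V k` commutes with `T`, the squared norm contains only traces against `Vₖ* Vₖ` and `Vₖ
  -- Vₖ*`, which cancel after summing over `k`.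
  have key : ∀ k, trace ((V k * Tᴴ - Tᴴ * V k)ᴴ * (V k * Tᴴ - Tᴴ * V k)) =
      (trace ((V k)ᴴ * V k * (Tᴴ * T)) - trace (V k * (V k)ᴴ * (Tᴴ * T))) -
      (trace ((V k)ᴴ * V k * (T * Tᴴ)) - trace (V k * (V k)ᴴ * (T * Tᴴ))) := by
    intro k
    have e1 : trace (T * (V k)ᴴ * (V k * Tᴴ)) = trace ((V k)ᴴ * V k * (Tᴴ * T)) := by
      simpa only [mul_assoc] using trace_mul_comm T ((V k)ᴴ * (V k * Tᴴ))
    have e2 : trace (T * (V k)ᴴ * (Tᴴ * V k)) = trace (V k * (V k)ᴴ * (Tᴴ * T)) := by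
      have h1 := trace_mul_comm (T * (V k)ᴴ * Tᴴ) (V k)
      have h2 := trace_mul_comm T (V k * (V k)ᴴ * Tᴴ)
      rw [← mul_assoc (V k), ← mul_assoc (V k), hT] at h1
      simp only [mul_assoc] at h1 h2 ⊢
      rw [h1, h2]
    have e3 : trace ((V k)ᴴ * T * (V k * Tᴴ)) = trace ((V k)ᴴ * V k * (T * Tᴴ)) := by
      rw [mul_assoc, ← mul_assoc T, ← hT]; simp only [mul_assoc]
    have e4 : trace ((V k)ᴴ * T * (Tᴴ * V k)) = trace (V k * (V k)ᴴ * (T * Tᴴ)) := by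
      simpa only [mul_assoc] using trace_mul_comm ((V k)ᴴ * (T * Tᴴ)) (V k)
    simp only [conjTranspose_sub, conjTranspose_mul, conjTranspose_conjTranspose, sub_mul, mul_sub,
      trace_sub, e1, e2, e3, e4]
    ring
  simp only [key, Finset.sum_sub_distrib, sum_trace_conjTranspose_mul_self_mul h, sub_self]

/-- The invariant subspaces of the Lindblad terms of a unital system are reducing. -/
theorem commute_of_invariant (h : IsUnital (lindbladOperator H V))
    {P : Matrix (Fin n) (Fin n) ℂ} (hP : Pᴴ = P) (hPP : P * P = P)
    (hinv : ∀ k, P * V k * P = V k * P) (k : Fin r) : V k * P = P * V k := by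
  refine sub_eq_zero.mp (eq_zero_of_sum_trace_eq_zero (D := fun k => V k * P - P * V k) ?_ k)
  have key : ∀ k, trace ((V k * P - P * V k)ᴴ * (V k * P - P * V k)) =
      trace (V k * (V k)ᴴ * P) - trace ((V k)ᴴ * V k * P) := by
    intro k
    have hinv' : P * (V k)ᴴ * P = P * (V k)ᴴ := by
      have := congrArg conjTranspose (hinv k)
      simpa [hP, mul_assoc] using this
    have e1 : trace (P * (V k)ᴴ * (V k * P)) = trace ((V k)ᴴ * V k * P) := by
      simpa only [mul_assoc, hPP] using trace_mul_comm P ((V k)ᴴ * (V k * P))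
    have e2 : trace (P * (V k)ᴴ * (P * V k)) = trace ((V k)ᴴ * V k * P) := by
      rw [← mul_assoc, hinv', mul_assoc, trace_mul_comm]
    have e3 : trace ((V k)ᴴ * P * (V k * P)) = trace ((V k)ᴴ * V k * P) := by
      rw [mul_assoc, ← mul_assoc P, hinv, mul_assoc]
    have e4 : trace ((V k)ᴴ * P * (P * V k)) = trace (V k * (V k)ᴴ * P) := by
      rw [mul_assoc, ← mul_assoc P, hPP]
      simpa only [mul_assoc] using trace_mul_comm ((V k)ᴴ * P) (V k)
    simp only [conjTranspose_sub, conjTranspose_mul, hP, sub_mul, mul_sub, trace_sub, e1, e2, e3,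
      e4]
    ring
  simp only [key, Finset.sum_sub_distrib, sum_trace_conjTranspose_mul_self_mul h, sub_self]

/-- The rate of change of the purity is minus the sum of squared commutators. -/
theorem two_mul_trace_mul_lindbladOperator (h : IsUnital (lindbladOperator H V))
    {ρ : Matrix (Fin n) (Fin n) ℂ} (hρ : ρᴴ = ρ) :
    2 * trace (ρ * lindbladOperator H V ρ) =
      ∑ k, trace ((V k * ρ - ρ * V k)ᴴ * (V k * ρ - ρ * V k)) := by
  have key : ∀ k, trace ((V k * ρ - ρ * V k)ᴴ * (V k * ρ - ρ * V k)) =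
      trace ((V k)ᴴ * V k * (ρ * ρ)) + trace (V k * (V k)ᴴ * (ρ * ρ)) -
        2 * trace (ρ * (V k * ρ * (V k)ᴴ)) := by
    intro k
    have e1 : trace (ρ * (V k)ᴴ * (V k * ρ)) = trace ((V k)ᴴ * V k * (ρ * ρ)) := by
      simpa only [mul_assoc] using trace_mul_comm ρ ((V k)ᴴ * (V k * ρ))
    have e2 : trace (ρ * (V k)ᴴ * (ρ * V k)) = trace (ρ * (V k * ρ * (V k)ᴴ)) := by
      simpa only [mul_assoc] using trace_mul_comm (ρ * (V k)ᴴ) (ρ * V k)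
    have e3 : trace ((V k)ᴴ * ρ * (V k * ρ)) = trace (ρ * (V k * ρ * (V k)ᴴ)) := by
      simpa only [mul_assoc] using trace_mul_comm ((V k)ᴴ) (ρ * (V k * ρ))
    have e4 : trace ((V k)ᴴ * ρ * (ρ * V k)) = trace (V k * (V k)ᴴ * (ρ * ρ)) := by
      simpa only [mul_assoc] using trace_mul_comm ((V k)ᴴ * (ρ * ρ)) (V k)
    simp only [conjTranspose_sub, conjTranspose_mul, hρ, sub_mul, mul_sub, trace_sub, e1, e2, e3,
      e4]
    ring
  have hL : trace (ρ * lindbladOperator H V ρ) = ∑ k, (trace ((V k)ᴴ * V k * (ρ * ρ)) -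
      trace (ρ * (V k * ρ * (V k)ᴴ))) := by
    change trace (ρ * (Complex.I • (H * ρ - ρ * H) + ∑ k, ((1 / 2 : ℂ) •
      ((V k)ᴴ * V k * ρ + ρ * ((V k)ᴴ * V k)) - V k * ρ * (V k)ᴴ))) = _
    have e0 : trace (ρ * (ρ * H)) = trace (ρ * (H * ρ)) := by
      simpa only [mul_assoc] using trace_mul_comm ρ (ρ * H)
    have e1 : ∀ k, trace (ρ * ((V k)ᴴ * V k * ρ)) = trace ((V k)ᴴ * V k * (ρ * ρ)) := by
      intro k
      simpa only [mul_assoc] using trace_mul_comm ρ ((V k)ᴴ * (V k * ρ))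
    have e2 : ∀ k, trace (ρ * (ρ * ((V k)ᴴ * V k))) = trace ((V k)ᴴ * V k * (ρ * ρ)) := by
      intro k
      rw [← mul_assoc, trace_mul_comm]
    rw [mul_add, Matrix.mul_smul, mul_sub, trace_add, trace_smul, trace_sub, e0, sub_self,
      smul_zero, zero_add, Finset.mul_sum, trace_sum]
    refine Finset.sum_congr rfl fun k _ => ?_
    rw [mul_sub, Matrix.mul_smul, mul_add, trace_sub, trace_smul, trace_add, e1, e2, smul_eq_mul]
    ring
  rw [hL]
  simp only [key, Finset.sum_sub_distrib, Finset.sum_add_distrib,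
    ← sum_trace_conjTranspose_mul_self_mul h, ← Finset.mul_sum]
  ring

theorem exists_isOfType_relaxationAlgebra (h : IsUnital (lindbladOperator H V)) :
    ∃ τ, IsOfType (relaxationAlgebra V) τ := by
  refine exists_isOfType (fun T hT => commute_of_mem_relaxationAlgebra
    (conjTranspose_commute h fun k => hT _ (mem_relaxationAlgebra V k))) fun P hP hinv =>
    commute_of_mem_relaxationAlgebra (commute_of_invariant h hP ?_ fun k =>
      hinv _ (mem_relaxationAlgebra V k))
  -- Invariance under `M = 1` says that `P` is idempotent.
  simpa using hinv 1 (one_mem _)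

theorem conjTranspose_conj_diagonal (U : Matrix (Fin n) (Fin n) ℂ) (x : Fin n → ℝ) :
    (U * diagonal (fun j => (x j : ℂ)) * star U)ᴴ = U * diagonal (fun j => (x j : ℂ)) * star U := by
  simp [star_eq_conjTranspose, diagonal_conjTranspose, mul_assoc, Pi.star_def]

/-- Links the reduced vector field to the purity: the pairing with `x` is half the derivative of `tr
ρ²` along `-L`. -/
theorem sum_mul_inducedField (L : Matrix (Fin n) (Fin n) ℂ →ₗ[ℂ] Matrix (Fin n) (Fin n) ℂ)
    (U : Matrix (Fin n) (Fin n) ℂ) (x : Fin n → ℝ) :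
    ∑ i, x i * inducedField L U x i = -(trace ((U * diagonal (fun j => (x j : ℂ)) * star U) *
      L (U * diagonal (fun j => (x j : ℂ)) * star U))).re := by
  have : trace ((U * diagonal (fun j => (x j : ℂ)) * star U) *
      L (U * diagonal (fun j => (x j : ℂ)) * star U)) = trace (diagonal (fun j => (x j : ℂ)) *
        (star U * L (U * diagonal (fun j => (x j : ℂ)) * star U) * U)) := by
    have := trace_mul_comm U (diagonal (fun j => (x j : ℂ)) * star U *
      L (U * diagonal (fun j => (x j : ℂ)) * star U))
    simpa only [mul_assoc] using this
  rw [this, trace, Complex.re_sum, ← Finset.sum_neg_distrib]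
  refine Finset.sum_congr rfl fun i _ => ?_
  rw [diag_apply, diagonal_mul, Complex.re_ofReal_mul, inducedField, mul_neg]

open scoped ComplexOrder in
/-- At a stabilizable point, some state with that spectrum commutes with all Lindblad terms. -/
theorem exists_commute_of_mem_stab (h : IsUnital (lindbladOperator H V)) {x : Fin n → ℝ}
    (hx : x ∈ stab (lindbladOperator H V)) :
    ∃ U ∈ unitaryGroup (Fin n) ℂ, ∀ M ∈ relaxationAlgebra V,
      M * (U * diagonal (fun j => (x j : ℂ)) * star U) =
        U * diagonal (fun j => (x j : ℂ)) * star U * M := by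
  -- Otherwise all derivatives, and with them `0`, would lie in an open half-space bounded by a
  -- hyperplane through `0`.
  obtain ⟨y, ⟨U, hU, rfl⟩, hy⟩ : ∃ y ∈ derv (lindbladOperator H V) x, 0 ≤ ∑ i, x i * y i := by
    by_contra! hlt
    have hconv : Convex ℝ {y : Fin n → ℝ | ∑ i, x i * y i < 0} :=
      convex_halfSpace_lt (f := fun y : Fin n → ℝ => ∑ i, x i * y i)
        ⟨fun a b => by simp [mul_add, Finset.sum_add_distrib],
          fun c a => by simp [Finset.mul_sum, mul_left_comm]⟩ 0
    have h0 : ∑ i, x i * (0 : Fin n → ℝ) i < 0 :=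
      convexHull_min (fun y hy => hlt y hy) hconv hx.2
    simp at h0
  refine ⟨U, (mem_specialUnitaryGroup_iff.mp hU).1, commute_of_mem_relaxationAlgebra fun k => ?_⟩
  rw [sum_mul_inducedField] at hy
  have h2 := two_mul_trace_mul_lindbladOperator h (conjTranspose_conj_diagonal U x)
  refine sub_eq_zero.mp (eq_zero_of_sum_trace_eq_zero (D := fun k =>
    V k * (U * diagonal (fun j => (x j : ℂ)) * star U) -
      U * diagonal (fun j => (x j : ℂ)) * star U * V k) ?_ k)
  have hpos := Finset.sum_nonneg fun (k : Fin r) (_ : k ∈ Finset.univ) =>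
    trace_conjTranspose_mul_self_nonneg (V k * (U * diagonal (fun j => (x j : ℂ)) * star U) -
      U * diagonal (fun j => (x j : ℂ)) * star U * V k)
  obtain ⟨hre, him⟩ := Complex.le_def.mp hpos
  have h2re := congrArg Complex.re h2
  simp only [Complex.mul_re, Complex.re_ofNat, Complex.im_ofNat, zero_mul, sub_zero] at h2re
  refine Complex.ext (le_antisymm ?_ hre) him.symm
  rw [← h2re, Complex.zero_re]
  linarith

/-- An `n`-th root of the conjugate determinant is a phase that normalizes the determinant without
changing conjugation by `U`. -/
theorem exists_smul_mem_specialUnitaryGroup (hn : n ≠ 0) {U : Matrix (Fin n) (Fin n) ℂ}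
    (hU : U ∈ unitaryGroup (Fin n) ℂ) :
    ∃ c : ℂ, c * star c = 1 ∧ c • U ∈ specialUnitaryGroup (Fin n) ℂ := by
  obtain ⟨c, hc⟩ := IsAlgClosed.exists_pow_nat_eq (star U.det) (Nat.pos_of_ne_zero hn)
  have hdet : U.det * star U.det = 1 := by
    rw [← det_conjTranspose, ← det_mul, ← star_eq_conjTranspose, mem_unitaryGroup_iff.mp hU,
      det_one]
  have hc1 : c * star c = 1 := by
    have h1 : (c * star c) ^ n = 1 := by
      rw [mul_pow, ← star_pow, hc, star_star, mul_comm, hdet]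
    have h2 : c * star c = ((‖c‖ ^ 2 : ℝ) : ℂ) := by
      rw [Complex.star_def, Complex.mul_conj, Complex.normSq_eq_norm_sq]
    rw [h2] at h1 ⊢
    have h3 : (‖c‖ ^ 2 : ℝ) ^ n = 1 := by exact_mod_cast h1
    rw [(pow_eq_one_iff_of_nonneg (by positivity) hn).mp h3]
    simp
  refine ⟨c, hc1, mem_specialUnitaryGroup_iff.mpr ⟨?_, ?_⟩⟩
  · rw [mem_unitaryGroup_iff, star_smul, smul_mul_smul_comm, mem_unitaryGroup_iff.mp hU, hc1,
      one_smul]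
  · rw [det_smul, Fintype.card_fin, hc, mul_comm, hdet]

theorem mem_strongStab_of_exists_commute (h : IsUnital (lindbladOperator H V)) (hn : n ≠ 0)
    {x : Fin n → ℝ} (hx : x ∈ stdSimplex ℝ (Fin n))
    (hU : ∃ U ∈ unitaryGroup (Fin n) ℂ, ∀ M ∈ relaxationAlgebra V,
      M * (U * diagonal (fun j => (x j : ℂ)) * star U) =
        U * diagonal (fun j => (x j : ℂ)) * star U * M) :
    x ∈ strongStab (lindbladOperator H V) := by
  obtain ⟨U₀, hU₀, hcomm⟩ := hU
  obtain ⟨c, hc, hU⟩ := exists_smul_mem_specialUnitaryGroup hn hU₀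
  have hconj : (c • U₀) * diagonal (fun j => (x j : ℂ)) * star (c • U₀) =
      U₀ * diagonal (fun j => (x j : ℂ)) * star U₀ := by
    rw [star_smul, smul_mul_assoc, smul_mul_smul_comm, hc, one_smul]
  rw [← hconj] at hcomm
  generalize c • U₀ = U at hU hcomm
  have hUU := mem_unitaryGroup_iff'.mp (mem_specialUnitaryGroup_iff.mp hU).1
  refine ⟨hx, U, hU, ?_⟩
  let ρ := U * diagonal (fun j => (x j : ℂ)) * star U
  have hρ : ρᴴ = ρ := conjTranspose_conj_diagonal U x
  have h1 : ∀ k, V k * ρ = ρ * V k := fun k => hcomm _ (mem_relaxationAlgebra V k)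
  have h2 : ∀ k, (V k)ᴴ * ρ = ρ * (V k)ᴴ := fun k => by
    have := congrArg conjTranspose (h1 k)
    rw [conjTranspose_mul (V k), conjTranspose_mul ρ, hρ] at this
    exact this.symm
  have hL : lindbladOperator H V ρ = Complex.I • (H * ρ - ρ * H) := by
    change Complex.I • (H * ρ - ρ * H) + ∑ k, ((1 / 2 : ℂ) •
      ((V k)ᴴ * V k * ρ + ρ * ((V k)ᴴ * V k)) - V k * ρ * (V k)ᴴ) = _
    have : ∀ k, (1 / 2 : ℂ) • ((V k)ᴴ * V k * ρ + ρ * ((V k)ᴴ * V k)) - V k * ρ * (V k)ᴴ =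
        ρ * ((V k)ᴴ * V k) - ρ * (V k * (V k)ᴴ) := by
      intro k
      rw [mul_assoc, h1, ← mul_assoc, h2, mul_assoc, ← two_smul ℂ, smul_smul, mul_assoc ρ]
      norm_num
    simp only [this, Finset.sum_sub_distrib, ← Finset.mul_sum, sum_conjTranspose_mul_self_eq h,
      sub_self, add_zero]
  ext i
  -- Only the Hamiltonian term survives; in the eigenbasis of `ρ` it is a commutator with a diagonal
  -- matrix.
  have hdiag : star U * lindbladOperator H V ρ * U = Complex.I •
      (star U * H * U * diagonal (fun j => (x j : ℂ)) -
        diagonal (fun j => (x j : ℂ)) * (star U * H * U)) := by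
    rw [hL, Matrix.mul_smul, Matrix.smul_mul, mul_sub, sub_mul]
    simp only [ρ, mul_assoc, hUU, mul_one]
    simp only [← mul_assoc (star U) U, hUU, one_mul]
  change (0 : ℝ) = -((star U * lindbladOperator H V ρ * U) i i).re
  rw [hdiag, Matrix.smul_apply, Matrix.sub_apply, mul_diagonal, diagonal_mul, mul_comm, sub_self]
  simp

end Dissipation

end Lindblad

end

theorem mainTheorem5 {n r : ℕ} (hn : 2 ≤ n)
    (H : Matrix (Fin n) (Fin n) ℂ) (hH : H.IsHermitian)
    (V : Fin r → Matrix (Fin n) (Fin n) ℂ)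
    (hunital : Lindblad.IsUnital (Lindblad.lindbladOperator H V)) :
    (∃! τ : Multiset ℕ, Lindblad.IsOfType (Lindblad.relaxationAlgebra V) τ) ∧
    (∀ τ : Multiset ℕ, Lindblad.IsOfType (Lindblad.relaxationAlgebra V) τ →
      ∀ x ∈ stdSimplex ℝ (Fin n),
        (x ∈ Lindblad.stab (Lindblad.lindbladOperator H V) ↔
          Lindblad.Refines τ (Lindblad.multiplicities x))) ∧
    Lindblad.stab (Lindblad.lindbladOperator H V) =
      Lindblad.strongStab (Lindblad.lindbladOperator H V) := by
  have htype := Lindblad.exists_isOfType_relaxationAlgebra hunital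
  have hstrong : ∀ x ∈ stdSimplex ℝ (Fin n), ∀ τ,
      Lindblad.IsOfType (Lindblad.relaxationAlgebra V) τ →
      Lindblad.Refines τ (Lindblad.multiplicities x) →
      x ∈ Lindblad.strongStab (Lindblad.lindbladOperator H V) := fun x hx τ hτ href =>
    Lindblad.mem_strongStab_of_exists_commute hunital (by omega) hx
      ((Lindblad.exists_commute_conj_diagonal_iff hτ x).mpr href)
  have hrefines : ∀ x ∈ Lindblad.stab (Lindblad.lindbladOperator H V), ∀ τ,
      Lindblad.IsOfType (Lindblad.relaxationAlgebra V) τ →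
      Lindblad.Refines τ (Lindblad.multiplicities x) := fun x hx τ hτ =>
    (Lindblad.exists_commute_conj_diagonal_iff hτ x).mp
      (Lindblad.exists_commute_of_mem_stab hunital hx)
  have hsub : ∀ x ∈ Lindblad.strongStab (Lindblad.lindbladOperator H V),
      x ∈ Lindblad.stab (Lindblad.lindbladOperator H V) :=
    fun x hx => ⟨hx.1, subset_convexHull ℝ _ hx.2⟩
  obtain ⟨τ, hτ⟩ := htype
  refine ⟨⟨τ, hτ, fun τ' hτ' => Lindblad.isOfType_unique hτ' hτ⟩, fun τ' hτ' x hx =>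
    ⟨fun h => hrefines x h τ' hτ', fun h => hsub x (hstrong x hx τ' hτ' h)⟩, ?_⟩
  exact Set.Subset.antisymm (fun x hx => hstrong x hx.1 τ hτ (hrefines x hx τ hτ)) hsub
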